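/- Let $\Phi$ be a separable real Banach space with dual $\mathcal Z=\Phi^*$. For a probability space $(\Omega,\mathcal A,\pi)$, a $\mathcal Z$-graphon on $(\Omega,\mathcal A,\pi)$ is a symmetric function $W:\Omega\times\Omega\to\mathcal Z$ such that $(x,y)\mapsto\langle\varphi,W(x,y)\rangle$ is measurable with respect to the completion $\overline{\mathcal A\times\mathcal A}$ of the product $\sigma$-algebra (under $\pi\times\pi$) for every $\varphi\in\Phi$, and $(x,y)\mapsto\|W(x,y)\|_{\mathcal Z}$ lies in $L^p(\pi\times\pi)$ for all $1\le p<\infty$; $\|W\|_p$ denotes the $L^p$-norm of the latter function. The graphon $W$ is - strong, if $(x,y)\mapsto\langle\varphi,W(x,y)\rangle$ is $\mathcal A\times\mathcal A$-measurable for every $\varphi\in\Phi$; - almost twin-free, if there is a $\pi$-null set $N$ such that no two distinct points $x_1,x_2\in\Omega\setminus N$ are twins, i.e. satisfy $W(x_1,y)=W(x_2,y)$ for almost all $y$; - Lebesguian, if $(\Omega,\mathcal A,\pi)$ is a Lebesgue (standard) probability space in the sense of Rohlin: $\pi$ is complete and there are sets $B_1,B_2,\ldots\in\mathcal A$ that separate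 the points of $\Omega$, such that every $A\in\mathcal A$ is contained in some $C\in\sigma(B_1,B_2,\ldots)$ with $\pi(C\setminus A)=0$, and such that, with $B_n^{1}=B_n$ and $B_n^{0}=\Omega\setminus B_n$, the intersection $\bigcap_n B_n^{\varepsilon_n}$ is non-empty for almost every $\varepsilon\in\{0,1\}^{\mathbb N}$ with respect to the image of $\pi$ under $x\mapsto(\mathbf 1_{B_n}(x))_n$. A weak isomorphism from a graphon $U$ on $(\Omega_1,\mathcal A_1,\pi_1)$ to a graphon $V$ on $(\Omega_2,\mathcal A_2,\pi_2)$ is a map $\eta:\Omega_1\to\Omega_2$ that is measure preserving from the completion $(\Omega_1,\overline{\mathcal A_1},\overline{\pi_1})$ into $(\Omega_2,\mathcal A_2,\pi_2)$ and satisfies $V(\eta(x),\eta(y))=U(x,y)$ for $\pi_1\times\pi_1$-almost all $(x,y)$. Then for every $\mathcal Z$-graphon $W$ on an arbitrary probability space $(\Omega,\mathcal A,\pi)$ there exist a probability space $(\widetilde\Omega,\widetilde{\mathcal A},\widetilde\pi)$, an almost twin-free, strong, Lebesguian $\mathcal Z$-graphon $\widetilde W$ on it, and a weak isomorphism from $W$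 to $\widetilde W$; moreover $\|W\|_p=\|\widetilde W\|_p$ for all $1\le p<\infty$. -/

import Mathlib

open MeasureTheory Set
open scoped ENNReal

/-- Weak-* measurability of a map `W` into the dual `Z = Φ*` of a Banach space `Φ`: every
evaluation `ω ↦ ⟨φ, W ω⟩`, `φ ∈ Φ`, is measurable. -/
def WeakStarMeasurable {Φ : Type*} [NormedAddCommGroup Φ] [NormedSpace ℝ Φ]
    {Ω : Type*} [MeasurableSpace Ω] (W : Ω → StrongDual ℝ Φ) : Prop :=
  ∀ φ : Φ, Measurable (fun ω => W ω φ)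

/-- Weak-* measurability with respect to the completion of the `σ`-algebra under `μ`. -/
def WeakStarNullMeasurable {Φ : Type*} [NormedAddCommGroup Φ] [NormedSpace ℝ Φ]
    {Ω : Type*} [MeasurableSpace Ω] (W : Ω → StrongDual ℝ Φ) (μ : Measure Ω) : Prop :=
  ∀ φ : Φ, NullMeasurable (fun ω => W ω φ) μ

/-- A `Z`-graphon on `(Ω, 𝒜, π)`, where `Z = Φ*`: a symmetric function `W : Ω × Ω → Z` which is
weak-* measurable with respect to the completion of `𝒜 × 𝒜` and whose pointwise norm lies in
`L^p` for all `1 ≤ p < ∞`. -/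
structure IsGraphon {Φ : Type*} [NormedAddCommGroup Φ] [NormedSpace ℝ Φ]
    {Ω : Type*} [MeasurableSpace Ω] (π : Measure Ω) (W : Ω → Ω → StrongDual ℝ Φ) : Prop where
  symm : ∀ x y, W x y = W y x
  weakStarNullMeasurable : WeakStarNullMeasurable (fun z : Ω × Ω => W z.1 z.2) (π.prod π)
  memLp : ∀ p : ℝ, 1 ≤ p → MemLp (fun z : Ω × Ω => ‖W z.1 z.2‖) (ENNReal.ofReal p) (π.prod π)

/-- The `p`-norm `‖W‖_p` of a graphon: the `L^p`-norm of `(x, y) ↦ ‖W(x, y)‖_Z`. -/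
noncomputable def graphonNorm {Φ : Type*} [NormedAddCommGroup Φ] [NormedSpace ℝ Φ]
    {Ω : Type*} [MeasurableSpace Ω] (π : Measure Ω) (W : Ω → Ω → StrongDual ℝ Φ) (p : ℝ) : ℝ≥0∞ :=
  eLpNorm (fun z : Ω × Ω => ‖W z.1 z.2‖) (ENNReal.ofReal p) (π.prod π)

/-- A graphon is strong if it is weak-* measurable with respect to `𝒜 × 𝒜` itself, without
completion. -/
def IsStrongGraphon {Φ : Type*} [NormedAddCommGroup Φ] [NormedSpace ℝ Φ]
    {Ω : Type*} [MeasurableSpace Ω] (W : Ω → Ω → StrongDual ℝ Φ) : Prop :=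
  WeakStarMeasurable (fun z : Ω × Ω => W z.1 z.2)

/-- Two points `x₁`, `x₂` are twins if `W(x₁, y) = W(x₂, y)` for almost all `y`. -/
def AreTwins {Φ : Type*} [NormedAddCommGroup Φ] [NormedSpace ℝ Φ]
    {Ω : Type*} [MeasurableSpace Ω] (π : Measure Ω) (W : Ω → Ω → StrongDual ℝ Φ)
    (x₁ x₂ : Ω) : Prop :=
  ∀ᵐ y ∂π, W x₁ y = W x₂ y

/-- A graphon is almost twin-free if, off a null set, no two distinct points are twins. -/
def IsAlmostTwinFree {Φ : Type*} [NormedAddCommGroup Φ] [NormedSpace ℝ Φ]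
    {Ω : Type*} [MeasurableSpace Ω] (π : Measure Ω) (W : Ω → Ω → StrongDual ℝ Φ) : Prop :=
  ∃ N : Set Ω, π N = 0 ∧ ∀ x₁ ∉ N, ∀ x₂ ∉ N, AreTwins π W x₁ x₂ → x₁ = x₂

/-- The map `Ω → {0,1}^ℕ` recording which of the sets `B n` a point belongs to. -/
def membershipCode {Ω : Type*} (B : ℕ → Set Ω) (x : Ω) (n : ℕ) : Prop := x ∈ B n

/-- Lebesgue (standard) spaces in the sense of Rohlin: the measure is complete, and there is a
basis, i.e. a sequence of measurable sets `B n` which separates points and such that every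
measurable set has a superset in the `σ`-algebra generated by the `B n` differing from it by a null
set, with respect to which the space is complete mod 0: writing `B n ^ 1 = B n` and
`B n ^ 0 = (B n)ᶜ`, the intersection `⋂ n, B n ^ (ε n)` is nonempty for almost every sequence
`ε ∈ {0,1}^ℕ` (almost every with respect to the image measure). -/
structure IsLebesgueSpace {Ω : Type*} [MeasurableSpace Ω] (π : Measure Ω) : Prop where
  isComplete : π.IsComplete
  exists_basis : ∃ B : ℕ → Set Ω,
    (∀ n, MeasurableSet (B n)) ∧
    (∀ x y, (∀ n, x ∈ B n ↔ y ∈ B n) → x = y) ∧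
    (∀ A, MeasurableSet A →
      ∃ C, MeasurableSet[MeasurableSpace.generateFrom (range B)] C ∧ A ⊆ C ∧ π (C \ A) = 0) ∧
    ∀ᵐ ε ∂(π.map (membershipCode B)), ε ∈ range (membershipCode B)

/-- `η : Ω₁ → Ω₂` is a weak isomorphism from the graphon `U` to the graphon `V`: it is measure
preserving from the completion of `(Ω₁, 𝒜₁, π₁)` into `(Ω₂, 𝒜₂, π₂)`, and the pull-back of `V`
under `η` is almost everywhere equal to `U`. -/
structure IsWeakIsomorphism {Φ : Type*} [NormedAddCommGroup Φ] [NormedSpace ℝ Φ]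
    {Ω₁ Ω₂ : Type*} [MeasurableSpace Ω₁] [MeasurableSpace Ω₂]
    (π₁ : Measure Ω₁) (π₂ : Measure Ω₂)
    (U : Ω₁ → Ω₁ → StrongDual ℝ Φ) (V : Ω₂ → Ω₂ → StrongDual ℝ Φ) (η : Ω₁ → Ω₂) : Prop where
  measurePreserving :
    MeasurePreserving (α := NullMeasurableSpace Ω₁ π₁) (β := Ω₂) η π₁.completion π₂
  pullback_ae_eq : ∀ᵐ z ∂(π₁.prod π₁), V (η z.1) (η z.2) = U z.1 z.2

/-! Twins are identified by sending a point to a code of its section `W x`; the quotient lives on a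
standard Borel space with the completed image measure. Since Φ is separable, a functional is
determined by its values on a dense sequence, so `exists_dual_code` turns functionals into numbers
in [0, 1]. After an a.e. modification the kernel is measurable, so it involves only countably many
measurable sets of Ω, and `Measurable.exists_eq_comp_prodMap` replaces Ω by ℝ. On ℝ a section is
coded by its integrals over rational half-lines, which determine it almost everywhere. It is
recovered measurably from its code as a Radon–Nikodym density (`exists_measurable_of_sectionCode`).
Symmetry carries the factorization to the second variable, and twin codes have equal integrals,
hence coincide off a null set (`exists_twinFree_factor`). Decoding and symmetrizing give the
graphon. -/

open ProbabilityTheory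

/-! ### Reduction from Ω to the real line -/

/-- A measurable subset of a product is measurable with respect to the product of countably
generated sub-`σ`-algebras. -/
lemma MeasurableSet.exists_countable_generateFrom_prod {Ω : Type*} [MeasurableSpace Ω]
    {S : Set (Ω × Ω)} (hS : MeasurableSet S) :
    ∃ 𝒜 : Set (Set Ω), 𝒜.Countable ∧ (∀ A ∈ 𝒜, MeasurableSet A) ∧
      MeasurableSet[(MeasurableSpace.generateFrom 𝒜).prod (MeasurableSpace.generateFrom 𝒜)] S := by
  have mono : ∀ {𝒜 ℬ : Set (Set Ω)}, 𝒜 ⊆ ℬ → ∀ T : Set (Ω × Ω),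
      MeasurableSet[(MeasurableSpace.generateFrom 𝒜).prod (MeasurableSpace.generateFrom 𝒜)] T →
      MeasurableSet[(MeasurableSpace.generateFrom ℬ).prod (MeasurableSpace.generateFrom ℬ)] T := by
    intro 𝒜 ℬ h T hT
    have h' := MeasurableSpace.generateFrom_mono h
    exact (sup_le_sup (MeasurableSpace.comap_mono h') (MeasurableSpace.comap_mono h')) T hT
  rw [← generateFrom_prod] at hS
  induction S, hS using MeasurableSpace.generateFrom_induction with
  | hC T hT _ =>
    obtain ⟨A, hA, B, hB, rfl⟩ := hT
    refine ⟨{A, B}, by simp, ?_, ?_⟩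
    · rintro _ (rfl | rfl)
      exacts [hA, hB]
    · refine @MeasurableSet.prod _ _ (MeasurableSpace.generateFrom {A, B})
        (MeasurableSpace.generateFrom {A, B}) _ _ ?_ ?_
      exacts [MeasurableSpace.measurableSet_generateFrom (by simp),
        MeasurableSpace.measurableSet_generateFrom (by simp)]
  | empty => exact ⟨∅, by simp, by simp, @MeasurableSet.empty _ (MeasurableSpace.prod _ _)⟩
  | compl T _ ih =>
    obtain ⟨𝒜, h1, h2, h3⟩ := ih
    exact ⟨𝒜, h1, h2, h3.compl⟩
  | iUnion T _ ih =>
    choose 𝒜 h1 h2 h3 using ih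
    refine ⟨⋃ n, 𝒜 n, countable_iUnion h1, ?_, ?_⟩
    · simp only [mem_iUnion]
      rintro A ⟨n, hn⟩
      exact h2 n A hn
    · exact MeasurableSet.iUnion fun n => mono (subset_iUnion 𝒜 n) _ (h3 n)

/-- A measurable function on `Ω × Ω` factors through `ξ × ξ` for a real random variable `ξ`. -/
lemma Measurable.exists_eq_comp_prodMap {Ω : Type*} [MeasurableSpace Ω] {f : Ω × Ω → ℝ≥0∞}
    (hf : Measurable f) :
    ∃ (ξ : Ω → ℝ) (G : ℝ × ℝ → ℝ≥0∞), Measurable ξ ∧ Measurable G ∧ f = G ∘ Prod.map ξ ξ := by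
  have hS n := (hf (MeasurableSpace.measurableSet_natGeneratingSequence
    (α := ℝ≥0∞) n)).exists_countable_generateFrom_prod
  choose 𝒜 h1 h2 h3 using hS
  set ℬ := ⋃ n, 𝒜 n with hℬ
  have hcount : Countable ℬ := countable_iUnion h1
  have hmeas : ∀ A ∈ ℬ, MeasurableSet A := by
    simp only [hℬ, mem_iUnion]
    rintro A ⟨n, hn⟩
    exact h2 n A hn
  let ζ : Ω → (ℬ → Prop) := fun x A => x ∈ A.1
  have hζ : Measurable ζ :=
    measurable_pi_lambda _ fun A => measurable_mem.2 (hmeas A.1 A.2)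
  -- A countable power of `Prop` is standard Borel, so countably many indicators merge into one real
  -- variable.
  have he := measurableEmbedding_embeddingReal (ℬ → Prop)
  have hle n : MeasurableSpace.generateFrom (𝒜 n) ≤
      MeasurableSpace.comap (embeddingReal (ℬ → Prop) ∘ ζ) inferInstance := by
    rw [← MeasurableSpace.comap_comp, he.comap_eq]
    refine MeasurableSpace.generateFrom_le fun A hA => ?_
    refine ⟨{p | p ⟨A, mem_iUnion.2 ⟨n, hA⟩⟩}, ?_, rfl⟩
    exact measurableSet_setOfPred.2 (measurable_pi_apply _)
  have hf' : Measurable[MeasurableSpace.comap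
      (Prod.map (embeddingReal (ℬ → Prop) ∘ ζ) (embeddingReal (ℬ → Prop) ∘ ζ))
      (MeasurableSpace.prod inferInstance inferInstance)] f := by
    rw [MeasurableSpace.comap_prodMap]
    have h := @measurable_generateFrom _ _ (MeasurableSpace.prod
      (MeasurableSpace.comap (embeddingReal (ℬ → Prop) ∘ ζ) inferInstance)
      (MeasurableSpace.comap (embeddingReal (ℬ → Prop) ∘ ζ) inferInstance))
      (range (MeasurableSpace.natGeneratingSequence ℝ≥0∞)) f ?_
    · rwa [MeasurableSpace.generateFrom_natGeneratingSequence] at h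
    rintro _ ⟨n, rfl⟩
    exact (sup_le_sup (MeasurableSpace.comap_mono (hle n)) (MeasurableSpace.comap_mono (hle n)))
      _ (h3 n)
  obtain ⟨G, hG, rfl⟩ := hf'.exists_eq_measurable_comp
  exact ⟨_, G, he.measurable.comp hζ, hG, rfl⟩

/-! ### Quotient of a kernel on ℝ by the twin relation -/

/-- The density of a finite kernel `κ` with respect to `ν` has a jointly measurable version; it is
almost everywhere equal to any density `g` of any of the measures `κ a`. -/
lemma exists_measurable_density {α β : Type*} [MeasurableSpace α] [MeasurableSpace β]
    [MeasurableSpace.CountablyGenerated β] (ν : Measure β) [IsFiniteMeasure ν]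
    (κ : Kernel α β) [IsFiniteKernel κ] :
    ∃ R : α × β → ℝ≥0∞, Measurable R ∧ ∀ a, ∀ g : β → ℝ≥0∞, Measurable g →
      κ a = ν.withDensity g → ∀ᵐ y ∂ν, R (a, y) = g y := by
  refine ⟨fun p => κ.rnDeriv (Kernel.const α ν) p.1 p.2, Kernel.measurable_rnDeriv _ _, ?_⟩
  intro a g hg h
  have h1 : κ.rnDeriv (Kernel.const α ν) a =ᵐ[ν] (κ a).rnDeriv ν :=
    Kernel.rnDeriv_eq_rnDeriv_measure (κ := κ) (η := Kernel.const α ν) (a := a)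
  rw [h] at h1
  exact h1.trans (Measure.rnDeriv_withDensity ν hg)

lemma measurable_measure_of_Iic_rat {α : Type*} [MeasurableSpace α] {κ : α → Measure ℝ}
    [∀ a, IsFiniteMeasure (κ a)] (h : ∀ q : ℚ, Measurable fun a => κ a (Iic (q : ℝ))) :
    Measurable κ := by
  refine Measurable.measure_of_isPiSystem
    ((BorelSpace.measurable_eq (α := ℝ)).trans Real.borel_eq_generateFrom_Iic_rat)
    Real.isPiSystem_Iic_rat ?_ ?_
  · simp only [mem_iUnion, mem_singleton_iff]
    rintro _ ⟨q, rfl⟩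
    exact h q
  · have : (univ : Set ℝ) = ⋃ n : ℕ, Iic (((n : ℚ) : ℝ)) := by
      symm
      rw [eq_univ_iff_forall]
      intro x
      obtain ⟨n, hn⟩ := exists_nat_ge x
      exact mem_iUnion.2 ⟨n, by simpa using hn⟩
    have hmono : Monotone fun n : ℕ => Iic (((n : ℚ) : ℝ)) := fun m n hmn =>
      Iic_subset_Iic.2 (by exact_mod_cast hmn)
    simp_rw [this, hmono.measure_iUnion]
    exact Measurable.iSup fun n => h n

/-- The sequence of integrals of `G (x, ·)` over rational half-lines, which determines
`G (x, ·)` up to null sets. -/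
noncomputable def sectionCode (μ : Measure ℝ) (G : ℝ × ℝ → ℝ≥0∞) (x : ℝ) (q : ℚ) : ℝ≥0∞ :=
  ∫⁻ y in Iic (q : ℝ), G (x, y) ∂μ

lemma measurable_sectionCode (μ : Measure ℝ) [IsFiniteMeasure μ] {G : ℝ × ℝ → ℝ≥0∞}
    (hG : Measurable G) : Measurable (sectionCode μ G) :=
  measurable_pi_lambda _ fun _ => hG.lintegral_prod_right'

/-- The measures with densities `G (x, ·)` form a kernel measurable for the σ-algebra generated by
the code, because rational half-lines determine finite measures. A jointly measurable density over
that σ-algebra is a function of the code. -/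
lemma exists_measurable_of_sectionCode (μ : Measure ℝ) [IsFiniteMeasure μ] {G : ℝ × ℝ → ℝ≥0∞}
    (hG : Measurable G) (hG1 : ∀ p, G p ≤ 1) :
    ∃ H : (ℚ → ℝ≥0∞) × ℝ → ℝ≥0∞, Measurable H ∧ (∀ p, H p ≤ 1) ∧
      ∀ x, ∀ᵐ y ∂μ, H (sectionCode μ G x, y) = G (x, y) := by
  set F := sectionCode μ G with hF
  let κ : ℝ → Measure ℝ := fun x => μ.withDensity fun y => G (x, y)
  have hκu : ∀ x, κ x univ ≤ μ univ := fun x => by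
    rw [withDensity_apply _ MeasurableSet.univ, Measure.restrict_univ]
    calc ∫⁻ y, G (x, y) ∂μ ≤ ∫⁻ _, 1 ∂μ := lintegral_mono fun y => hG1 _
      _ = μ univ := by simp
  have : ∀ x, IsFiniteMeasure (κ x) := fun x => ⟨(hκu x).trans_lt (measure_lt_top _ _)⟩
  have hκ : Measurable[MeasurableSpace.comap F inferInstance] κ := by
    refine @measurable_measure_of_Iic_rat _ (MeasurableSpace.comap F inferInstance) κ _ fun q => ?_
    have : (fun x => κ x (Iic (q : ℝ))) = (fun u => u q) ∘ F := by
      ext x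
      exact withDensity_apply _ measurableSet_Iic
    rw [this]
    exact (measurable_pi_apply q).comp (comap_measurable F)
  obtain ⟨R, hR, hRG⟩ := @exists_measurable_density _ _ (MeasurableSpace.comap F inferInstance)
    _ _ μ _ (@Kernel.mk _ _ (MeasurableSpace.comap F inferInstance) _ κ hκ) ⟨μ univ, measure_lt_top _ _, hκu⟩
  have hR' : Measurable[MeasurableSpace.comap (Prod.map F id)
      (MeasurableSpace.prod inferInstance inferInstance)] R := by
    rw [MeasurableSpace.comap_prodMap, MeasurableSpace.comap_id]
    exact hR
  obtain ⟨H, hH, rfl⟩ := hR'.exists_eq_measurable_comp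
  -- Truncation bounds the density at every pair, including codes of no section; later this makes
  -- `κ₁` a finite kernel.
  refine ⟨fun p => min (H p) 1, hH.min measurable_const, fun p => min_le_right _ _, fun x => ?_⟩
  filter_upwards [hRG x (fun y => G (x, y)) (hG.comp measurable_prodMk_left) rfl] with y hy
  have hy' : H (F x, y) = G (x, y) := hy
  rw [hy', min_eq_left (hG1 _)]

/-- By symmetry, for almost every `x`, `H₁ (F x, y) = H₁ (F y, x)` for almost every `y`. The section
thus depends on `y` through `F y` only, and pushing it forward along `F` loses nothing. -/
lemma exists_twinFree_factor (μ : Measure ℝ) [IsProbabilityMeasure μ] {G : ℝ × ℝ → ℝ≥0∞}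
    (hG : Measurable G) (hG1 : ∀ p, G p ≤ 1)
    (hsymm : ∀ᵐ p ∂(μ.prod μ), G p = G p.swap) :
    ∃ (F : ℝ → ℚ → ℝ≥0∞) (H : (ℚ → ℝ≥0∞) × (ℚ → ℝ≥0∞) → ℝ≥0∞), Measurable F ∧ Measurable H ∧
      (∀ᵐ p ∂(μ.prod μ), H (F p.1, F p.2) = G p) ∧
      ∃ N : Set (ℚ → ℝ≥0∞), μ.map F N = 0 ∧ ∀ u ∉ N, ∀ v ∉ N,
        (∀ᵐ w ∂(μ.map F), H (u, w) = H (v, w)) → u = v := by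
  obtain ⟨H₁, hH₁, hH₁1, hH₁G⟩ := exists_measurable_of_sectionCode μ hG hG1
  have hF := measurable_sectionCode μ hG
  set F := sectionCode μ G with hFdef
  set ν := μ.map F with hν
  have : IsProbabilityMeasure ν := Measure.isProbabilityMeasure_map hF.aemeasurable
  -- the kernel sending `u` to the image under `F` of the measure with density `H₁ (u, ·)`
  let g : (ℚ → ℝ≥0∞) → ℝ → ℝ≥0∞ := fun u y => H₁ (u, y)
  have hg : Measurable (Function.uncurry g) := hH₁
  let κ₁ : Kernel (ℚ → ℝ≥0∞) ℝ := Kernel.withDensity (Kernel.const _ μ) g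
  have : IsFiniteKernel κ₁ := Kernel.isFiniteKernel_withDensity_of_bounded _ ENNReal.one_ne_top
    fun u y => hH₁1 _
  obtain ⟨H, hH, hHκ⟩ := exists_measurable_density ν (κ₁.map F)
  have hκ₁ u : κ₁ u = μ.withDensity (g u) := by
    rw [Kernel.withDensity_apply _ hg]; rfl
  have hset : MeasurableSet {p : ℝ × ℝ | H₁ (F p.1, p.2) = G p} :=
    measurableSet_eq_fun (hH₁.comp (by fun_prop)) hG
  have hae1 : ∀ᵐ p ∂(μ.prod μ), H₁ (F p.1, p.2) = G p :=
    (Measure.ae_prod_iff_ae_ae hset).2 (.of_forall hH₁G)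
  have hae2 : ∀ᵐ p ∂(μ.prod μ), H₁ (F p.2, p.1) = G p.swap :=
    Measure.measurePreserving_swap.quasiMeasurePreserving.ae hae1
  have hae3 : ∀ᵐ p ∂(μ.prod μ), H₁ (F p.1, p.2) = H₁ (F p.2, p.1) := by
    filter_upwards [hae1, hae2, hsymm] with p h1 h2 h3
    rw [h1, h2, h3]
  have hset4 : MeasurableSet {p : ℝ × ℝ | H (F p.1, F p.2) = H₁ (F p.1, p.2)} :=
    measurableSet_eq_fun (hH.comp (by fun_prop)) (hH₁.comp (by fun_prop))
  have hae4 : ∀ᵐ p ∂(μ.prod μ), H (F p.1, F p.2) = H₁ (F p.1, p.2) := by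
    refine (Measure.ae_prod_iff_ae_ae hset4).2 ?_
    filter_upwards [Measure.ae_ae_of_ae_prod hae3] with x hx
    have hq : Measurable fun v => H₁ (v, x) := hH₁.comp measurable_prodMk_right
    have hκx : κ₁.map F (F x) = ν.withDensity fun v => H₁ (v, x) := by
      ext s hs
      rw [Kernel.map_apply' _ hF _ hs, hκ₁, withDensity_apply _ (hF hs), withDensity_apply _ hs,
        hν, setLIntegral_map hs hq hF]
      exact lintegral_congr_ae (ae_restrict_of_ae hx)
    have := ae_of_ae_map hF.aemeasurable (hHκ (F x) _ hq hκx)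
    filter_upwards [this, hx] with y h1 h2
    exact h1.trans h2.symm
  refine ⟨F, H, hF, hH, ?_, ?_⟩
  · filter_upwards [hae1, hae4] with p h1 h2
    rw [h2, h1]
  have hset5 : MeasurableSet {p : (ℚ → ℝ≥0∞) × ℝ | H (p.1, F p.2) = H₁ p} :=
    measurableSet_eq_fun (hH.comp (by fun_prop)) hH₁
  have hae5 : ∀ᵐ u ∂ν, ∀ᵐ y ∂μ, H (u, F y) = H₁ (u, y) := by
    refine Measure.ae_ae_of_ae_prod (p := fun p : (ℚ → ℝ≥0∞) × ℝ => H (p.1, F p.2) = H₁ p) ?_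
    have : ν.prod μ = (μ.prod μ).map (Prod.map F id) := by
      rw [← Measure.map_prod_map _ _ hF measurable_id, Measure.map_id]
    rw [this, ae_map_iff (hF.prodMap measurable_id).aemeasurable hset5]
    exact hae4
  -- Almost every code is read off from its own section, so codes with a.e. equal sections are
  -- equal.
  have hae6 : ∀ᵐ u ∂ν, ∀ q : ℚ, ∫⁻ y in Iic (q : ℝ), H₁ (u, y) ∂μ = u q := by
    rw [ae_all_iff]
    intro q
    rw [hν, ae_map_iff hF.aemeasurable
      (measurableSet_eq_fun hH₁.lintegral_prod_right' (measurable_pi_apply q))]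
    refine .of_forall fun x => ?_
    exact lintegral_congr_ae (ae_restrict_of_ae (hH₁G x))
  have hae7 := hae5.and hae6
  refine ⟨_, hae7, fun u hu v hv huv => ?_⟩
  simp only [mem_compl_iff, mem_ofPred_eq, not_not] at hu hv
  ext q
  rw [← hu.2 q, ← hv.2 q]
  refine lintegral_congr_ae (ae_restrict_of_ae ?_)
  filter_upwards [hu.1, hv.1, ae_of_ae_map hF.aemeasurable huv] with y h1 h2 h3
  rw [← h1, ← h2, h3]

/-! ### Borel coding of the dual space -/

/-- The values of a functional on a dense sequence. -/
noncomputable def dualCoords {Φ : Type*} [NormedAddCommGroup Φ] [NormedSpace ℝ Φ]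
    [TopologicalSpace.SeparableSpace Φ] (z : StrongDual ℝ Φ) (n : ℕ) : ℝ :=
  z (TopologicalSpace.denseSeq Φ n)

section DualCoords

variable {Φ : Type*} [NormedAddCommGroup Φ] [NormedSpace ℝ Φ]
    [TopologicalSpace.SeparableSpace Φ]

lemma dualCoords_injective : Function.Injective (dualCoords (Φ := Φ)) := fun z w h => by
  refine DFunLike.coe_injective ?_
  exact (TopologicalSpace.denseRange_denseSeq Φ).equalizer z.continuous w.continuous h

/-- Banach–Alaoglu: balls are weak-* compact and the coordinates weak-* continuous. Measurability of
the range and of the norm both rest on this. -/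
lemma isClosed_image_dualCoords_closedBall (r : ℝ) :
    IsClosed (dualCoords '' Metric.closedBall (0 : StrongDual ℝ Φ) r) := by
  have hcont : Continuous fun z : WeakDual ℝ Φ => dualCoords (WeakDual.toStrongDual z) :=
    continuous_pi fun n => WeakDual.eval_continuous _
  have h := ((WeakDual.isCompact_closedBall (𝕜 := ℝ) (E := Φ) 0 r).image hcont).isClosed
  convert h using 1
  ext a
  constructor
  · rintro ⟨z, hz, rfl⟩
    exact ⟨StrongDual.toWeakDual z, hz, rfl⟩
  · rintro ⟨z, hz, rfl⟩
    exact ⟨_, hz, rfl⟩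

lemma measurableSet_range_dualCoords : MeasurableSet (range (dualCoords (Φ := Φ))) := by
  rw [← image_univ, ← Metric.iUnion_closedBall_nat (0 : StrongDual ℝ Φ), image_iUnion]
  exact MeasurableSet.iUnion fun n => (isClosed_image_dualCoords_closedBall _).measurableSet

/-- The left inverse of `dualCoords` which is zero off the range. -/
noncomputable def dualOfCoords (a : ℕ → ℝ) : StrongDual ℝ Φ :=
  Function.extend dualCoords id 0 a

lemma dualOfCoords_dualCoords (z : StrongDual ℝ Φ) : dualOfCoords (dualCoords z) = z :=
  dualCoords_injective.extend_apply _ _ _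

lemma dualOfCoords_of_notMem {a : ℕ → ℝ} (ha : a ∉ range (dualCoords (Φ := Φ))) :
    dualOfCoords (Φ := Φ) a = 0 :=
  Function.extend_apply' _ _ _ ha

lemma weakStarMeasurable_dualOfCoords : WeakStarMeasurable (dualOfCoords (Φ := Φ)) := by
  intro φ
  obtain ⟨x, hx, hlim⟩ := mem_closure_iff_seq_limit.1
    ((TopologicalSpace.denseRange_denseSeq Φ).closure_eq ▸ mem_univ φ)
  choose k hk using hx
  refine measurable_of_tendsto_metrizable
    (f := fun n (a : ℕ → ℝ) => dualOfCoords (Φ := Φ) a (x n)) (fun n => ?_)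
    (tendsto_pi_nhds.2 fun a => ((dualOfCoords (Φ := Φ) a).continuous.tendsto φ).comp hlim)
  classical
  have : (fun a : ℕ → ℝ => dualOfCoords (Φ := Φ) a (x n)) =
      fun a => if a ∈ range (dualCoords (Φ := Φ)) then a (k n) else 0 := by
    ext a
    split_ifs with ha
    · obtain ⟨z, rfl⟩ := ha
      rw [dualOfCoords_dualCoords, ← hk]
      rfl
    · rw [dualOfCoords_of_notMem ha]
      rfl
  rw [this]
  exact Measurable.ite measurableSet_range_dualCoords (measurable_pi_apply _) measurable_const

lemma measurable_norm_dualOfCoords : Measurable fun a => ‖dualOfCoords (Φ := Φ) a‖ := by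
  refine measurable_of_Iic fun r => ?_
  rcases lt_or_ge r 0 with hr | hr
  · convert MeasurableSet.empty
    ext a
    simpa using hr.trans_le (norm_nonneg _)
  -- Off the range the decoded functional is 0, whose norm is at most `r`; hence the complement.
  · convert (isClosed_image_dualCoords_closedBall (Φ := Φ) r).measurableSet.union
      (measurableSet_range_dualCoords (Φ := Φ)).compl
    ext a
    by_cases ha : a ∈ range (dualCoords (Φ := Φ))
    · obtain ⟨z, rfl⟩ := ha
      simp [dualOfCoords_dualCoords, dualCoords_injective.mem_set_image]
    · simpa [dualOfCoords_of_notMem ha, hr] using Or.inr (by simpa using ha)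

/-- A weak-* bimeasurable coding of the dual by numbers in `[0, 1]`. -/
lemma exists_dual_code (Φ : Type*) [NormedAddCommGroup Φ] [NormedSpace ℝ Φ]
    [TopologicalSpace.SeparableSpace Φ] :
    ∃ (S : StrongDual ℝ Φ → ℝ≥0∞) (d : ℝ≥0∞ → StrongDual ℝ Φ),
      (∀ z, S z ≤ 1) ∧ (∀ z, d (S z) = z) ∧ WeakStarMeasurable d ∧ (Measurable fun a => ‖d a‖) ∧
      (∀ {Ω : Type _} [MeasurableSpace Ω] (W : Ω → StrongDual ℝ Φ), WeakStarMeasurable W →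
        Measurable (S ∘ W)) ∧
      ∀ {Ω : Type _} [MeasurableSpace Ω] (μ : Measure Ω) (W : Ω → StrongDual ℝ Φ),
        WeakStarNullMeasurable W μ → AEMeasurable (S ∘ W) μ := by
  have he := measurableEmbedding_sigmoid_comp_embeddingReal (ℕ → ℝ)
  set e := unitInterval.sigmoid ∘ embeddingReal (ℕ → ℝ) with he_def
  let j : (ℕ → ℝ) → ℝ≥0∞ := fun a => ENNReal.ofReal (e a)
  have hj : Measurable j := (measurable_subtype_coe.comp he.measurable).ennreal_ofReal
  have hj_inj : Function.Injective j := fun a b hab => he.injective <| Subtype.ext <|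
    (ENNReal.ofReal_eq_ofReal_iff (e a).2.1 (e b).2.1).1 hab
  have hj' : MeasurableEmbedding j := hj.measurableEmbedding hj_inj
  have hinv := hj'.measurable_invFun
  refine ⟨fun z => j (dualCoords z), fun a => dualOfCoords (hj'.invFun a), ?_, ?_, ?_, ?_, ?_, ?_⟩
  · exact fun z => ENNReal.ofReal_le_one.2 (e _).2.2
  · intro z
    exact (congrArg dualOfCoords (hj'.leftInverse_invFun _)).trans (dualOfCoords_dualCoords z)
  · exact fun φ => (weakStarMeasurable_dualOfCoords φ).comp hinv
  · exact measurable_norm_dualOfCoords.comp hinv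
  · intro Ω _ W hW
    exact hj.comp (measurable_pi_lambda _ fun n => hW _)
  · intro Ω _ μ W hW
    exact hj.comp_aemeasurable (aemeasurable_pi_iff.2 fun n => (hW _).aemeasurable)

end DualCoords

/-! ### Completions as Lebesgue spaces -/

/-- The completion of a Borel probability measure on a standard Borel space is a Lebesgue space. -/
lemma isLebesgueSpace_completion {X : Type*} [MeasurableSpace X] [StandardBorelSpace X]
    (ν : Measure X) : IsLebesgueSpace (Ω := NullMeasurableSpace X ν) ν.completion := by
  let B := MeasurableSpace.natGeneratingSequence X
  have hB : ∀ n, MeasurableSet (B n) := MeasurableSpace.measurableSet_natGeneratingSequence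
  have hB' : ∀ n, @MeasurableSet (NullMeasurableSpace X ν) _ (B n) :=
    fun n => (hB n).nullMeasurableSet
  have hsep : ∀ x y, (∀ n, x ∈ B n ↔ y ∈ B n) → x = y := by
    have : @MeasurableSpace.SeparatesPoints X (MeasurableSpace.generateFrom (range B)) := by
      rw [MeasurableSpace.generateFrom_natGeneratingSequence X]
      infer_instance
    refine fun x y h => MeasurableSpace.separating_of_generateFrom (range B) x y ?_
    rintro _ ⟨n, rfl⟩
    exact h n
  refine ⟨inferInstance, B, hB', hsep, ?_, ?_⟩
  · intro A hA
    obtain ⟨C, hAC, hC, hCA⟩ := NullMeasurableSet.exists_measurable_superset_ae_eq (μ := ν) hA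
    refine ⟨C, ?_, hAC, ?_⟩
    · change MeasurableSet[MeasurableSpace.generateFrom
        (range (MeasurableSpace.natGeneratingSequence X))] C
      rwa [MeasurableSpace.generateFrom_natGeneratingSequence X]
    · exact ae_le_set.1 hCA.le
  · have hmeas : Measurable (membershipCode B) :=
      measurable_pi_lambda _ fun n => measurable_mem.2 (hB n)
    have hmeas' : Measurable (α := NullMeasurableSpace X ν) (membershipCode B) :=
      measurable_pi_lambda _ fun n => measurable_mem.2 (hB' n)
    have hinj : Function.Injective (membershipCode B) := fun x y h =>
      hsep x y fun n => iff_of_eq (congrFun h n)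
    -- Lusin–Souslin: an injective Borel map on a standard Borel space has measurable range.
    refine (ae_map_iff hmeas'.aemeasurable
      (hmeas.measurableEmbedding hinj).measurableSet_range).2 ?_
    exact .of_forall fun x => mem_range_self x

lemma measurePreserving_of_completion {X : Type*} [MeasurableSpace X] (ν : Measure X) :
    MeasurePreserving (α := NullMeasurableSpace X ν) (β := X) (fun x => x) ν.completion ν := by
  have hm : Measurable (α := NullMeasurableSpace X ν) (β := X) fun x => x :=
    fun s hs => hs.nullMeasurableSet
  exact ⟨hm, Measure.ext fun s hs => Measure.map_apply hm hs⟩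

lemma MeasureTheory.MeasurePreserving.completion {Ω X : Type*} [MeasurableSpace Ω]
    [MeasurableSpace X] {π : Measure Ω} {ν : Measure X} {η : Ω → X}
    (hη : MeasurePreserving η π ν) :
    MeasurePreserving (α := NullMeasurableSpace Ω π) (β := NullMeasurableSpace X ν) η
      π.completion ν.completion := by
  have hm : Measurable (α := NullMeasurableSpace Ω π) (β := NullMeasurableSpace X ν) η :=
    fun s hs => NullMeasurableSet.preimage hs hη.quasiMeasurePreserving
  refine ⟨hm, ?_⟩
  ext s hs
  exact (Measure.map_apply hm hs).trans (hη.measure_preimage hs)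

/-! ### Construction of the twin-free graphon -/

/-- Every graphon pulls back from a weak-* Borel measurable kernel, almost without twins, on a
standard Borel space. -/
lemma IsGraphon.exists_twinFree_factor {Φ : Type*} [NormedAddCommGroup Φ] [NormedSpace ℝ Φ]
    [TopologicalSpace.SeparableSpace Φ] {Ω : Type*} [MeasurableSpace Ω] {π : Measure Ω}
    [IsProbabilityMeasure π] {W : Ω → Ω → StrongDual ℝ Φ} (hW : IsGraphon π W) :
    ∃ (η : Ω → ℚ → ℝ≥0∞) (V : (ℚ → ℝ≥0∞) → (ℚ → ℝ≥0∞) → StrongDual ℝ Φ), Measurable η ∧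
      (∀ u v, V u v = V v u) ∧ IsStrongGraphon V ∧
      (Measurable fun p : (ℚ → ℝ≥0∞) × (ℚ → ℝ≥0∞) => ‖V p.1 p.2‖) ∧
      (∀ᵐ z ∂(π.prod π), V (η z.1) (η z.2) = W z.1 z.2) ∧ IsAlmostTwinFree (π.map η) V := by
  obtain ⟨S, d, hS1, hdS, hd, hdn, hSm, hSnull⟩ := exists_dual_code Φ
  have hae := hSnull _ _ hW.weakStarNullMeasurable
  obtain ⟨ξ, G₀, hξ, hG₀, hfG⟩ := hae.measurable_mk.exists_eq_comp_prodMap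
  set μ := π.map ξ with hμ
  have : IsProbabilityMeasure μ := Measure.isProbabilityMeasure_map hξ.aemeasurable
  have hμμ : μ.prod μ = (π.prod π).map (Prod.map ξ ξ) := Measure.map_prod_map _ _ hξ hξ
  have hξξ : Measurable (Prod.map ξ ξ) := hξ.prodMap hξ
  let G : ℝ × ℝ → ℝ≥0∞ := fun p => min (G₀ p) 1
  have hG : Measurable G := hG₀.min measurable_const
  have hGW : ∀ᵐ z ∂(π.prod π), G (ξ z.1, ξ z.2) = S (W z.1 z.2) := by
    filter_upwards [hae.ae_eq_mk] with z hz
    have h : G₀ (ξ z.1, ξ z.2) = S (W z.1 z.2) := (congrFun hfG z).symm.trans hz.symm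
    simp only [G, h, min_eq_left (hS1 _)]
  have hswap : ∀ᵐ z ∂(π.prod π), G (ξ z.2, ξ z.1) = S (W z.2 z.1) :=
    Measure.measurePreserving_swap.quasiMeasurePreserving.ae hGW
  have hsymm : ∀ᵐ p ∂(μ.prod μ), G p = G p.swap := by
    rw [hμμ]
    refine (ae_map_iff hξξ.aemeasurable
      (measurableSet_eq_fun hG (hG.comp measurable_swap))).2 ?_
    filter_upwards [hGW, hswap] with z h1 h2
    exact h1.trans ((congrArg S (hW.symm _ _)).trans h2.symm)
  obtain ⟨F, H, hF, hH, hHG, N, hN, hNtwin⟩ :=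
    _root_.exists_twinFree_factor μ hG (fun _ => min_le_right _ _) hsymm
  have hη : Measurable fun x => F (ξ x) := hF.comp hξ
  have hν : π.map (fun x => F (ξ x)) = μ.map F := (Measure.map_map hF hξ).symm
  have hHW : ∀ᵐ z ∂(π.prod π), H (F (ξ z.1), F (ξ z.2)) = S (W z.1 z.2) := by
    rw [hμμ] at hHG
    filter_upwards [ae_of_ae_map hξξ.aemeasurable hHG, hGW] with z h1 h2
    exact h1.trans h2
  have hHW' : ∀ᵐ z ∂(π.prod π), H (F (ξ z.2), F (ξ z.1)) = S (W z.2 z.1) :=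
    Measure.measurePreserving_swap.quasiMeasurePreserving.ae hHW
  -- `H` is symmetric only almost everywhere, while a graphon is symmetric everywhere; averaging
  -- repairs this without changing the pull-back off a null set.
  let V : (ℚ → ℝ≥0∞) → (ℚ → ℝ≥0∞) → StrongDual ℝ Φ := fun u v =>
    (2⁻¹ : ℝ) • (d (H (u, v)) + d (H (v, u)))
  have hVm : IsStrongGraphon V := fun φ =>
    (((hd φ).comp hH).add ((hd φ).comp (hH.comp measurable_swap))).const_smul (2⁻¹ : ℝ)
  have hSV : Measurable fun p : (ℚ → ℝ≥0∞) × (ℚ → ℝ≥0∞) => S (V p.1 p.2) := hSm _ hVm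
  have hVW : ∀ᵐ z ∂(π.prod π), V (F (ξ z.1)) (F (ξ z.2)) = W z.1 z.2 := by
    filter_upwards [hHW, hHW'] with z h1 h2
    simp only [V, h1, h2, hdS, hW.symm z.2 z.1]
    rw [← two_smul ℝ, smul_smul]
    norm_num
  have hVH : ∀ᵐ u ∂(π.map fun x => F (ξ x)), ∀ᵐ v ∂(π.map fun x => F (ξ x)),
      S (V u v) = H (u, v) := by
    have : IsProbabilityMeasure (π.map fun x => F (ξ x)) :=
      Measure.isProbabilityMeasure_map hη.aemeasurable
    refine Measure.ae_ae_of_ae_prod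
      (p := fun p : (ℚ → ℝ≥0∞) × (ℚ → ℝ≥0∞) => S (V p.1 p.2) = H p) ?_
    rw [Measure.map_prod_map _ _ hη hη]
    refine (ae_map_iff (hη.prodMap hη).aemeasurable (measurableSet_eq_fun hSV hH)).2 ?_
    filter_upwards [hHW, hVW] with z h1 h2
    exact (congrArg S h2).trans h1.symm
  refine ⟨fun x => F (ξ x), V, hη, ?_, hVm, ?_, hVW,
    N ∪ {u | ∀ᵐ v ∂(π.map fun x => F (ξ x)), S (V u v) = H (u, v)}ᶜ,
    measure_union_null (hν ▸ hN) hVH, ?_⟩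
  · exact fun u v => congrArg ((2⁻¹ : ℝ) • ·) (add_comm _ _)
  · simpa only [Function.comp_def, hdS] using hdn.comp hSV
  · intro u hu v hv huv
    simp only [mem_union, mem_compl_iff, mem_ofPred_eq, not_or, not_not] at hu hv
    refine hNtwin u hu.1 v hv.1 ?_
    rw [← hν]
    filter_upwards [hu.2, hv.2, huv] with w h1 h2 h3
    rw [← h1, ← h2, h3]

theorem mainTheorem3 {Φ : Type*} [NormedAddCommGroup Φ] [NormedSpace ℝ Φ] [CompleteSpace Φ]
    [TopologicalSpace.SeparableSpace Φ]
    {Ω : Type*} [MeasurableSpace Ω] (π : Measure Ω) [IsProbabilityMeasure π]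
    (W : Ω → Ω → StrongDual ℝ Φ) (hW : IsGraphon π W) :
    ∃ (Ω' : Type) (_ : MeasurableSpace Ω') (π' : Measure Ω') (W' : Ω' → Ω' → StrongDual ℝ Φ)
      (η : Ω → Ω'),
      IsProbabilityMeasure π' ∧ IsGraphon π' W' ∧
      IsAlmostTwinFree π' W' ∧ IsStrongGraphon W' ∧ IsLebesgueSpace π' ∧
      IsWeakIsomorphism π π' W W' η ∧
      ∀ p : ℝ, 1 ≤ p → graphonNorm π W p = graphonNorm π' W' p := by
  obtain ⟨η, V, hη, hsymm, hstrong, hnorm, hVW, htwin⟩ := hW.exists_twinFree_factor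
  set ν := π.map η with hν
  have hηmp : MeasurePreserving η π ν := hη.measurePreserving π
  have hνprob : IsProbabilityMeasure ν := Measure.isProbabilityMeasure_map hη.aemeasurable
  have hprob : IsProbabilityMeasure (α := NullMeasurableSpace (ℚ → ℝ≥0∞) ν) ν.completion :=
    ⟨hνprob.measure_univ⟩
  have hid := measurePreserving_of_completion ν
  have hidid := hid.prod hid
  have hstrong' : IsStrongGraphon (Ω := NullMeasurableSpace (ℚ → ℝ≥0∞) ν) V :=
    fun φ => (hstrong φ).comp hidid.measurable
  have hnorm' : Measurable fun p : NullMeasurableSpace (ℚ → ℝ≥0∞) ν ×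
      NullMeasurableSpace (ℚ → ℝ≥0∞) ν => ‖V p.1 p.2‖ := hnorm.comp hidid.measurable
  have heq : ∀ p : ℝ, graphonNorm π W p =
      graphonNorm (Ω := NullMeasurableSpace (ℚ → ℝ≥0∞) ν) ν.completion V p := fun p => by
    have h1 := eLpNorm_comp_measurePreserving (p := ENNReal.ofReal p)
      hnorm.aestronglyMeasurable (hηmp.prod hηmp)
    have h2 := eLpNorm_comp_measurePreserving (p := ENNReal.ofReal p)
      hnorm.aestronglyMeasurable hidid
    refine Eq.trans (eLpNorm_congr_ae ?_) (h1.trans h2.symm)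
    filter_upwards [hVW] with z hz
    exact (congrArg norm hz).symm
  -- `ν` and its completion have the same null sets, so `htwin` applies unchanged.
  refine ⟨NullMeasurableSpace (ℚ → ℝ≥0∞) ν, inferInstance, ν.completion, V, η, hprob,
    ⟨hsymm, fun φ => (hstrong' φ).nullMeasurable, fun p hp => ⟨hnorm'.aestronglyMeasurable, ?_⟩⟩,
    htwin, hstrong', isLebesgueSpace_completion ν, ⟨hηmp.completion, hVW⟩, fun p _ => heq p⟩
  exact (heq p).symm.trans_lt (hW.memLp p hp).2
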